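/- Let $n,m\ge 1$. Let $\varphi:(0,\infty)\to(0,\infty)$ be essentially nondecreasing, i.e. there is $\rho>0$ with $\varphi(t)\le\rho\,\varphi(s)$ whenever $0<t\le s$, and suppose $\lim_{t\to\infty}\varphi(t)/t=0$. Cubes $Q\subset\mathbb{R}^n$ have sides parallel to the coordinate axes, and $l(Q)$ and $|Q|$ denote the side length and the Lebesgue measure of $Q$. For measurable $\vec f=(f_1,\dots,f_m)$ put $$\mathcal{M}_\varphi\vec f(x)=\sup_{Q\ni x}\varphi(|Q|)\prod_{i=1}^m\frac1{|Q|}\int_Q|f_i| .$$ For a Banach function space $X$ over $\mathbb{R}^n$ with respect to Lebesgue measure (in the sense of Luxemburg, as in Bennett--Sharpley), let $X'$ be its associate space, with $\|g\|_{X'}=\sup\{\int|fg|:\|f\|_X\le1\}$, and put $$\|f\|_{X,Q}=\|\delta_{l(Q)}(f\chi_Q)\|_X,\quad \delta_af(x)=f(ax),\qquad M_Xf(x)=\sup_{Q\ni x}\|f\|_{X,Q}.$$ Let $1<p_1,\dots,p_m<\infty$, $\frac1p=\sum_{i=1}^m\frac1{p_i}$ and $\frac1m<p\le q<\infty$. Let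 $Y_1,\dots,Y_m$ be Banach function spaces over $\mathbb{R}^n$ such that $M_{Y_i'}$ is bounded from $L^{p_i}(\mathbb{R}^n)$ to $L^{p_i}(\mathbb{R}^n)$ for each $i$. Then there is a finite constant $K$, depending only on $n,m,\varphi,p_1,\dots,p_m,q,Y_1,\dots,Y_m$, with the following property. Let $\nu,w_1,\dots,w_m$ be weights, i.e. measurable functions $\mathbb{R}^n\to[0,\infty)$, such that for some constant $C>0$ and every cube $Q$ $$\varphi(|Q|)\,|Q|^{1/q-1/p}\left(\frac1{|Q|}\int_Q\nu^q\right)^{1/q}\prod_{i=1}^m\|w_i^{-1}\|_{Y_i,Q}\le C,$$ where $w_i^{-1}=\infty$ at points with $w_i=0$, and $0\cdot\infty=0$. Then $$\|\nu\,\mathcal{M}_\varphi\vec f\,\|_{L^q}\le K\,C\prod_{i=1}^m\|f_iw_i\|_{L^{p_i}}$$ for all measurable $f_1,\dots,f_m$ with $f_iw_i\in L^{p_i}(\mathbb{R}^n)$, $i=1,\dots,m$. -/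

import Mathlib

open MeasureTheory Filter Topology
open scoped ENNReal NNReal

/-- An (open) cube in `ℝⁿ` with sides parallel to the coordinate axes, given by its lower corner and
its side length. Taking closed or half-open cubes instead changes the averages below not at all and
the maximal functions only on null sets. -/
structure Cube (n : ℕ) where
  corner : Fin n → ℝ
  side : ℝ
  side_pos : 0 < side

namespace Cube

variable {n : ℕ}

/-- The points of the cube. -/
def toSet (Q : Cube n) : Set (Fin n → ℝ) :=
  Set.univ.pi fun j => Set.Ioo (Q.corner j) (Q.corner j + Q.side)

/-- The Lebesgue measure `|Q|`, as a real number. -/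
noncomputable def vol (Q : Cube n) : ℝ := volume.real Q.toSet

theorem vol_eq (Q : Cube n) : Q.vol = Q.side ^ n := by
  simp [vol, toSet, Measure.real, Real.volume_pi_Ioo, ENNReal.toReal_ofReal Q.side_pos.le]

end Cube

/-- A Banach function space over `ℝⁿ` with respect to Lebesgue measure, given by its Banach function
norm (in the sense of Luxemburg; Bennett and Sharpley, Chapter 1) on the cone of measurable
functions with values in `[0, ∞]`. The norm of a real function `f` is `norm |f|`, and the space
consists of the `f` for which this is finite. The values of `norm` at functions that are not
Lebesgue measurable carry no meaning. -/
structure BanachFunctionSpace (n : ℕ) where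
  norm : ((Fin n → ℝ) → ℝ≥0∞) → ℝ≥0∞
  norm_eq_zero_iff : ∀ f, AEMeasurable f volume → (norm f = 0 ↔ f =ᵐ[volume] 0)
  norm_const_mul : ∀ (a : ℝ≥0) f, AEMeasurable f volume →
    norm (fun x => a * f x) = a * norm f
  norm_add_le : ∀ f g, AEMeasurable f volume → AEMeasurable g volume →
    norm (fun x => f x + g x) ≤ norm f + norm g
  norm_mono : ∀ f g, AEMeasurable f volume → AEMeasurable g volume →
    (∀ᵐ x ∂volume, f x ≤ g x) → norm f ≤ norm g
  /-- The Fatou property: `0 ≤ f_k ↑ f` a.e. implies `norm f_k ↑ norm f`. -/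
  norm_iSup : ∀ f : ℕ → (Fin n → ℝ) → ℝ≥0∞, (∀ k, AEMeasurable (f k) volume) →
    (∀ᵐ x ∂volume, Monotone fun k => f k x) →
    norm (fun x => ⨆ k, f k x) = ⨆ k, norm (f k)
  norm_indicator_lt_top : ∀ E, MeasurableSet E → volume E < ∞ →
    norm (E.indicator fun _ => 1) < ∞
  setLIntegral_le : ∀ E, MeasurableSet E → volume E < ∞ →
    ∃ C : ℝ≥0, ∀ f, AEMeasurable f volume → ∫⁻ x in E, f x ≤ C * norm f

namespace BanachFunctionSpace

variable {n : ℕ}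

/-- The associate norm `‖g‖_{X'} = sup { ∫ f g : f ≥ 0 measurable, ‖f‖_X ≤ 1 }`. -/
noncomputable def assocNorm (X : BanachFunctionSpace n) (g : (Fin n → ℝ) → ℝ≥0∞) : ℝ≥0∞ :=
  ⨆ (f : (Fin n → ℝ) → ℝ≥0∞) (_ : AEMeasurable f volume) (_ : X.norm f ≤ 1), ∫⁻ x, f x * g x

theorem lintegral_le_assocNorm (X : BanachFunctionSpace n) {f : (Fin n → ℝ) → ℝ≥0∞}
    (g : (Fin n → ℝ) → ℝ≥0∞) (hf : AEMeasurable f volume) (h : X.norm f ≤ 1) :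
    ∫⁻ x, f x * g x ≤ X.assocNorm g :=
  le_iSup_of_le f (le_iSup_of_le hf (le_iSup_of_le h le_rfl))

theorem setLIntegral_le_assocNorm (X : BanachFunctionSpace n) (E : Set (Fin n → ℝ))
    (hE : MeasurableSet E) (hE' : volume E < ∞) :
    ∃ C : ℝ≥0, ∀ g, AEMeasurable g volume → ∫⁻ x in E, g x ≤ C * X.assocNorm g := by
  have hfin := X.norm_indicator_lt_top E hE hE'
  have hind : AEMeasurable (E.indicator fun _ => (1 : ℝ≥0∞)) volume :=
    (measurable_const.indicator hE).aemeasurable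
  set c : ℝ≥0 := (X.norm (E.indicator fun _ => 1)).toNNReal + 1 with hc
  have hc0 : (c : ℝ≥0∞) ≠ 0 := by simp [hc]
  have hle : X.norm (E.indicator fun _ => 1) ≤ c := by
    rw [hc, ENNReal.coe_add, ENNReal.coe_toNNReal hfin.ne]
    exact le_self_add
  refine ⟨c, fun g hg => ?_⟩
  have hinv : ((c⁻¹ : ℝ≥0) : ℝ≥0∞) = (c : ℝ≥0∞)⁻¹ := ENNReal.coe_inv (by exact_mod_cast hc0)
  have hone : X.norm (fun x => ((c⁻¹ : ℝ≥0) : ℝ≥0∞) * E.indicator (fun _ => 1) x) ≤ 1 := by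
    rw [X.norm_const_mul _ _ hind, hinv]
    calc (c : ℝ≥0∞)⁻¹ * _ ≤ (c : ℝ≥0∞)⁻¹ * c := by gcongr
      _ = 1 := ENNReal.inv_mul_cancel hc0 ENNReal.coe_ne_top
  have key := X.lintegral_le_assocNorm g (hind.const_mul _) hone
  have heq : ∫⁻ x, ((c⁻¹ : ℝ≥0) : ℝ≥0∞) * E.indicator (fun _ => 1) x * g x
      = (c : ℝ≥0∞)⁻¹ * ∫⁻ x in E, g x := by
    rw [← lintegral_indicator hE, ← hinv, ← lintegral_const_mul' _ _ ENNReal.coe_ne_top]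
    refine lintegral_congr fun x => ?_
    by_cases hx : x ∈ E <;> simp [hx]
  rw [heq] at key
  calc ∫⁻ x in E, g x = c * ((c : ℝ≥0∞)⁻¹ * ∫⁻ x in E, g x) := by
        rw [← mul_assoc, ENNReal.mul_inv_cancel hc0 ENNReal.coe_ne_top, one_mul]
    _ ≤ c * X.assocNorm g := by gcongr

/-- The associate space `X'` of a Banach function space `X`. -/
noncomputable def assoc (X : BanachFunctionSpace n) : BanachFunctionSpace n where
  norm := X.assocNorm
  norm_eq_zero_iff g hg := by
    constructor
    · intro h
      have hE : ∀ k : ℕ, ∀ᵐ x ∂volume, x ∈ Metric.ball (0 : Fin n → ℝ) k → g x = 0 := by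
        intro k
        obtain ⟨C, hC⟩ := X.setLIntegral_le_assocNorm (Metric.ball 0 k) measurableSet_ball
          measure_ball_lt_top
        have h0 := hC g hg
        rw [h, mul_zero, nonpos_iff_eq_zero, lintegral_eq_zero_iff' hg.restrict] at h0
        exact (ae_restrict_iff' measurableSet_ball).1 h0
      filter_upwards [ae_all_iff.2 hE] with x hx
      obtain ⟨k, hk⟩ := exists_nat_gt ‖x‖
      exact hx k (by simpa using hk)
    · intro h
      refine le_antisymm (iSup_le fun f => iSup_le fun _ => iSup_le fun _ => ?_) zero_le
      refine le_of_eq ?_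
      rw [lintegral_congr_ae (g := fun _ => 0) (h.mono fun x hx => by simp [hx])]
      simp
  norm_const_mul a g _ := by
    simp only [assocNorm, ENNReal.mul_iSup]
    refine iSup_congr fun f => iSup_congr fun _ => iSup_congr fun _ => ?_
    rw [← lintegral_const_mul' _ _ ENNReal.coe_ne_top]
    exact lintegral_congr fun x => by ring
  norm_add_le g h hg _ := by
    refine iSup_le fun f => iSup_le fun hf => iSup_le fun h1 => ?_
    simp only [mul_add]
    rw [lintegral_add_left' (f := fun x => f x * g x) (hf.mul hg)]
    exact add_le_add (X.lintegral_le_assocNorm g hf h1) (X.lintegral_le_assocNorm h hf h1)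
  norm_mono g h _ _ hgh := by
    refine iSup_le fun f => iSup_le fun hf => iSup_le fun h1 => ?_
    refine le_trans (lintegral_mono_ae ?_) (X.lintegral_le_assocNorm h hf h1)
    filter_upwards [hgh] with x hx
    gcongr
  norm_iSup g hg hmono := by
    have h1 : ∀ f : (Fin n → ℝ) → ℝ≥0∞, AEMeasurable f volume →
        ∫⁻ x, f x * ⨆ k, g k x = ⨆ k, ∫⁻ x, f x * g k x := by
      intro f hf
      simp only [ENNReal.mul_iSup]
      refine lintegral_iSup' (fun k => hf.mul (hg k)) ?_
      filter_upwards [hmono] with x hx i j hij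
      exact mul_le_mul_right (hx hij) (f x)
    refine le_antisymm (iSup_le fun f => iSup_le fun hf => iSup_le fun hf1 => ?_)
      (iSup_le fun k => iSup_le fun f => iSup_le fun hf => iSup_le fun hf1 => ?_)
    · rw [h1 f hf]
      exact iSup_mono fun k => X.lintegral_le_assocNorm (g k) hf hf1
    · refine le_trans ?_ (X.lintegral_le_assocNorm (fun x => ⨆ k, g k x) hf hf1)
      rw [h1 f hf]
      exact le_iSup (fun k => ∫⁻ x, f x * g k x) k
  norm_indicator_lt_top E hE hE' := by
    obtain ⟨C, hC⟩ := X.setLIntegral_le E hE hE'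
    refine lt_of_le_of_lt ?_ (ENNReal.coe_lt_top (r := C))
    refine iSup_le fun f => iSup_le fun hf => iSup_le fun h1 => ?_
    calc ∫⁻ x, f x * E.indicator (fun _ => 1) x = ∫⁻ x in E, f x := by
          rw [← lintegral_indicator hE]
          refine lintegral_congr fun x => ?_
          by_cases hx : x ∈ E <;> simp [hx]
      _ ≤ C * X.norm f := hC f hf
      _ ≤ C * 1 := by gcongr
      _ = C := mul_one _
  setLIntegral_le := X.setLIntegral_le_assocNorm

/-- The `X`-average `‖f‖_{X,Q} = ‖δ_{l(Q)}(f χ_Q)‖_X`, where `δ_a f(x) = f(a x)`. -/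
noncomputable def average (X : BanachFunctionSpace n) (f : (Fin n → ℝ) → ℝ≥0∞) (Q : Cube n) :
    ℝ≥0∞ :=
  X.norm fun x => Q.toSet.indicator f (Q.side • x)

/-- The maximal operator `M_X f(x) = sup_{Q ∋ x} ‖f‖_{X,Q}`. -/
noncomputable def maximal (X : BanachFunctionSpace n) (f : (Fin n → ℝ) → ℝ) (x : Fin n → ℝ) :
    ℝ≥0∞ :=
  ⨆ (Q : Cube n) (_ : x ∈ Q.toSet), X.average (fun y => ‖f y‖ₑ) Q

/-- `M_X : L^r(ℝⁿ) → L^r(ℝⁿ)` is bounded. -/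
def MaximalBoundedOn (X : BanachFunctionSpace n) (r : ℝ) : Prop :=
  ∃ A : ℝ≥0, ∀ f : (Fin n → ℝ) → ℝ, MemLp f (ENNReal.ofReal r) volume →
    eLpNorm (X.maximal f) (ENNReal.ofReal r) volume ≤ A * eLpNorm f (ENNReal.ofReal r) volume

end BanachFunctionSpace

/-- `φ`, as a function on `(0, ∞)`, is essentially nondecreasing. -/
def EssentiallyNondecreasing (φ : ℝ → ℝ) : Prop :=
  ∃ ρ : ℝ, 0 < ρ ∧ ∀ t s : ℝ, 0 < t → t ≤ s → φ t ≤ ρ * φ s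

/-- The multilinear maximal operator
`M_φ f(x) = sup_{Q ∋ x} φ(|Q|) ∏_i (1/|Q|) ∫_Q |f_i|`. -/
noncomputable def multilinearMaximal {n m : ℕ} (φ : ℝ → ℝ) (f : Fin m → (Fin n → ℝ) → ℝ)
    (x : Fin n → ℝ) : ℝ≥0∞ :=
  ⨆ (Q : Cube n) (_ : x ∈ Q.toSet),
    ENNReal.ofReal (φ Q.vol) * ∏ i, ⨍⁻ y in Q.toSet, ‖f i y‖ₑ ∂volume

/-! The proof reduces the norm inequality to a testing inequality on single cubes. Write `A_Q` for
the multilinear average of `f` over `Q` and `σ = ν^q dx`. Hölder's inequality between `Y_i` and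
`Y_i'`, applied to `f_i = w_i⁻¹ · (f_i w_i)`, together with the weight condition gives `A_Q^q σ(Q) ≤
(C^p |Q| c_Q)^(q/p)`, where `c_Q = (∏ ‖f_i w_i‖_{Y_i',Q})^p` (`multiAverage_rpow_mul_le`). On `Q`,
`c_Q` is at most `G = (∏ M_{Y_i'}(f_i w_i))^p`.

Over a dyadic grid, `∫ M^q dσ` is at most a sum of such terms over principal cubes, which are
maximal cubes with `b^k < A_Q ≤ b^(k+1)`. The packing property (`Cube.two_mul_measure_biUnion_le`)
leaves each principal cube a subset of at least half its measure, and these subsets overlap at most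
twice. Hence `∑ |Q| c_Q ≤ 4 ∫ G`. Since `q/p ≥ 1`, the power `q/p` can be taken outside the sum
(`NestedFamily.lintegral_maximal_rpow_le`). Hölder's inequality with `1/p = ∑ 1/p_i` and the
boundedness of `M_{Y_i'}` then control `∫ G`.

General cubes are reduced to `2^n` shifted grids with a coarsest scale `L` by the one-third trick;
the bound is independent of `L`, and `L → ∞` by monotone convergence. -/

theorem ENNReal.tsum_rpow_le_rpow_tsum {ι : Type*} (x : ι → ℝ≥0∞) {s : ℝ} (hs : 1 ≤ s) :
    ∑' i, x i ^ s ≤ (∑' i, x i) ^ s := by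
  have h : ∀ y : ℝ≥0∞, y ^ s = y * y ^ (s - 1) := fun y => by
    conv_rhs => rw [← ENNReal.rpow_one y, ← ENNReal.rpow_mul, one_mul,
      ← ENNReal.rpow_add_of_nonneg _ _ zero_le_one (by linarith)]
    congr 1
    ring
  rw [h (∑' i, x i), ← ENNReal.tsum_mul_right]
  refine ENNReal.tsum_le_tsum fun i => ?_
  rw [h]
  have hs' : 0 ≤ s - 1 := by linarith
  gcongr
  exact ENNReal.le_tsum i

/-! ### Stopping sets and the testing theorem for nested families. -/

/-- A family of sets with generations in `ℕ`, any two of which are disjoint or nested, such as the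
dyadic subcubes of the cubes of a fixed side length. -/
structure NestedFamily (ι α : Type*) where
  set : ι → Set α
  gen : ι → ℕ
  subset_of_gen_le : ∀ a b, gen a ≤ gen b → (set a ∩ set b).Nonempty → set b ⊆ set a
  eq_of_gen_eq : ∀ a b, gen a = gen b → (set a ∩ set b).Nonempty → a = b

namespace NestedFamily

variable {ι α : Type*} (N : NestedFamily ι α) (A : ι → ℝ≥0∞)

/-- The subfamily of the members with a given property. -/
def restrict (P : ι → Prop) : NestedFamily {a // P a} α where
  set a := N.set a
  gen a := N.gen a
  subset_of_gen_le a b := N.subset_of_gen_le a b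
  eq_of_gen_eq a b h h' := Subtype.ext (N.eq_of_gen_eq a b h h')

/-- The maximal operator `x ↦ sup_{Q ∋ x} A_Q` over the family. -/
noncomputable def maximal (x : α) : ℝ≥0∞ := ⨆ (a) (_ : x ∈ N.set a), A a

/-- The indices of the maximal sets on which `A` exceeds `t`. -/
def stopping (t : ℝ≥0∞) : Set ι :=
  {a | t < A a ∧ ∀ d, N.gen d < N.gen a → N.set a ⊆ N.set d → A d ≤ t}

/-- The union of the sets on which `A` exceeds `t`. -/
def levelSet (t : ℝ≥0∞) : Set α := ⋃ a ∈ N.stopping A t, N.set a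

variable {A}

/-- Generations are natural numbers, so among the members containing `x` with `A > t` there is one
of least generation, and it is a stopping set. -/
theorem exists_stopping {t : ℝ≥0∞} {a : ι} {x : α} (hx : x ∈ N.set a) (ht : t < A a) :
    ∃ c ∈ N.stopping A t, x ∈ N.set c := by
  classical
  have hex : ∃ j, ∃ c, N.gen c = j ∧ x ∈ N.set c ∧ t < A c := ⟨_, a, rfl, hx, ht⟩
  obtain ⟨c, hc, hxc, htc⟩ := Nat.find_spec hex
  refine ⟨c, ⟨htc, fun d hd hsub => ?_⟩, hxc⟩
  by_contra! h
  exact Nat.find_min hex (hc ▸ hd) ⟨d, rfl, hsub hxc, h⟩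

theorem levelSet_anti : Antitone (N.levelSet A) := by
  intro t t' h x hx
  simp only [levelSet, Set.mem_iUnion, exists_prop] at hx ⊢
  obtain ⟨a, ha, hxa⟩ := hx
  exact N.exists_stopping hxa (h.trans_lt ha.1)

theorem pairwiseDisjoint_stopping (t : ℝ≥0∞) : (N.stopping A t).PairwiseDisjoint N.set := by
  have key : ∀ a ∈ N.stopping A t, ∀ b ∈ N.stopping A t, N.gen a ≤ N.gen b →
      (N.set a ∩ N.set b).Nonempty → a = b := by
    intro a ha b hb hab hne
    rcases hab.eq_or_lt with h | h
    · exact N.eq_of_gen_eq a b h hne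
    · exact absurd (hb.2 a h (N.subset_of_gen_le a b hab hne)) ha.1.not_ge
  intro a ha b hb hab
  rw [Function.onFun, Set.disjoint_iff_inter_eq_empty]
  by_contra hne
  rw [← ne_eq, ← Set.nonempty_iff_ne_empty] at hne
  rcases le_total (N.gen a) (N.gen b) with h | h
  · exact hab (key a ha b hb h hne)
  · exact hab (key b hb a ha h (Set.inter_comm _ _ ▸ hne)).symm

theorem inter_levelSet_subset {t u : ℝ≥0∞} (htu : t ≤ u) {a : ι} (ha : a ∈ N.stopping A t) :
    N.set a ∩ N.levelSet A u ⊆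
      ⋃ c ∈ {c | c ∈ N.stopping A u ∧ N.set c ⊆ N.set a}, N.set c := by
  rintro x ⟨hxa, hx⟩
  simp only [levelSet, Set.mem_iUnion, exists_prop, Set.mem_ofPred_eq] at hx ⊢
  obtain ⟨c, hc, hxc⟩ := hx
  refine ⟨c, ⟨hc, ?_⟩, hxc⟩
  rcases le_or_gt (N.gen a) (N.gen c) with h | h
  · exact N.subset_of_gen_le a c h ⟨x, hxa, hxc⟩
  · have := ha.2 c h (N.subset_of_gen_le c a h.le ⟨x, hxc, hxa⟩)
    exact absurd (hc.1.trans_le this) htu.not_gt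

/-- The stopping sets at level `b ^ k` on which `A` is at most `b ^ (k + 1)`. -/
def principal (A : ι → ℝ≥0∞) (b : ℝ≥0∞) (k : ℤ) : Set ι :=
  {a | a ∈ N.stopping A (b ^ k) ∧ A a ≤ b ^ (k + 1)}

/-- A stopping set at level `b ^ k` may have `A` far above `b ^ (k + 1)`. It is then also a stopping
set at the level `b ^ l` just below its own `A`, because the sets around it have `A ≤ b ^ k ≤ b ^
l`. So principal sets suffice, and no comparison of `A` between consecutive generations is needed.
-/
theorem maximal_rpow_le {b : ℝ≥0∞} (hA : ∀ a, A a ≠ ∞) (hb : 1 < b) (hb' : b ≠ ∞) {q : ℝ} (hq : 0 < q)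
    (x : α) :
    N.maximal A x ^ q ≤
      ∑' (k : ℤ) (a : N.principal A b k), (N.set a).indicator (fun _ => (b ^ (k + 1)) ^ q) x := by
  set B := ∑' (k : ℤ) (a : N.principal A b k),
    (N.set a).indicator (fun _ => (b ^ (k + 1)) ^ q) x with hB
  suffices h : N.maximal A x ≤ B ^ q⁻¹ by
    calc N.maximal A x ^ q ≤ (B ^ q⁻¹) ^ q := by gcongr
      _ = B := ENNReal.rpow_inv_rpow hq.ne' B
  refine iSup₂_le fun c hc => ?_
  rcases eq_or_ne (A c) 0 with h0 | h0
  · simp [h0]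
  obtain ⟨k, hk, hk'⟩ := ENNReal.exists_mem_Ioc_zpow h0 (hA c) hb hb'
  obtain ⟨a, ha, hxa⟩ := N.exists_stopping hc hk
  obtain ⟨l, hl, hl'⟩ := ENNReal.exists_mem_Ioc_zpow (zero_le.trans_lt ha.1).ne' (hA a) hb hb'
  have hkl : k ≤ l := by
    by_contra! h
    exact absurd (ha.1.trans_le hl') (ENNReal.zpow_le_of_le hb.le (by lia)).not_gt
  have hmem : a ∈ N.principal A b l :=
    ⟨⟨hl, fun d hd hsub => (ha.2 d hd hsub).trans (ENNReal.zpow_le_of_le hb.le hkl)⟩, hl'⟩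
  have h1 : (b ^ (l + 1)) ^ q ≤ B := by
    refine le_trans ?_ (ENNReal.le_tsum l)
    refine le_trans ?_ (ENNReal.le_tsum (⟨a, hmem⟩ : N.principal A b l))
    simp [hxa]
  calc A c ≤ b ^ (l + 1) := hk'.trans (ENNReal.zpow_le_of_le hb.le (by lia))
    _ = ((b ^ (l + 1)) ^ q) ^ q⁻¹ := (ENNReal.rpow_rpow_inv hq.ne' _).symm
    _ ≤ B ^ q⁻¹ := by gcongr

/-- `A` satisfies the packing condition with parameter `b`: the sets inside `Q_a` on which `A` is
more than `b` times larger fill at most half of `Q_a`. -/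
def Packing [MeasurableSpace α] (N : NestedFamily ι α) (A : ι → ℝ≥0∞) (μ : Measure α)
    (b : ℝ≥0∞) : Prop :=
  ∀ (a : ι) (T : Set ι) (t : ℝ≥0∞), t ≠ 0 → t ≠ ∞ → T.PairwiseDisjoint N.set →
    (∀ c ∈ T, N.set c ⊆ N.set a ∧ t < A c) → b * A a ≤ t →
    2 * μ (⋃ c ∈ T, N.set c) ≤ μ (N.set a)

variable [MeasurableSpace α] {μ σ : Measure α} {b : ℝ≥0∞}

theorem measurableSet_levelSet [Countable ι] (hQ : ∀ a, MeasurableSet (N.set a)) (t : ℝ≥0∞) :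
    MeasurableSet (N.levelSet A t) :=
  MeasurableSet.biUnion (Set.to_countable _) fun a _ => hQ a

/-- The level is `k + 2` because packing needs a threshold of at least `b * A a`, while `A a` may be
as large as `b ^ (k + 1)`. -/
theorem measure_le_two_mul_diff [Countable ι] (hQ : ∀ a, MeasurableSet (N.set a))
    (hfin : ∀ a, μ (N.set a) ≠ ∞) (hb : 1 < b) (hb' : b ≠ ∞) (hN : N.Packing A μ b)
    {k : ℤ} {a : ι} (ha : a ∈ N.principal A b k) :
    μ (N.set a) ≤ 2 * μ (N.set a \ N.levelSet A (b ^ (k + 2))) := by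
  have hb0 : b ≠ 0 := (zero_lt_one.trans hb).ne'
  have h1 : 2 * μ (N.set a ∩ N.levelSet A (b ^ (k + 2))) ≤ μ (N.set a) := by
    refine (mul_le_mul_right (measure_mono (N.inter_levelSet_subset
      (ENNReal.zpow_le_of_le hb.le (by lia)) ha.1)) 2).trans ?_
    refine hN a _ (b ^ (k + 2)) (ENNReal.zpow_pos hb0 hb' _).ne' (ENNReal.zpow_lt_top hb0 hb' _).ne
      ((N.pairwiseDisjoint_stopping _).subset fun c hc => hc.1) (fun c hc => ⟨hc.2, hc.1.1⟩) ?_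
    calc b * A a ≤ b ^ (1 : ℤ) * b ^ (k + 1) := by rw [zpow_one]; gcongr; exact ha.2
      _ = b ^ (k + 2) := by rw [← ENNReal.zpow_add hb0 hb']; congr 1; ring
  have h2 := measure_inter_add_sdiff (μ := μ) (N.set a)
    (N.measurableSet_levelSet (A := A) hQ (b ^ (k + 2)))
  set u := μ (N.set a ∩ N.levelSet A (b ^ (k + 2)))
  set v := μ (N.set a \ N.levelSet A (b ^ (k + 2)))
  have hu : u ≠ ∞ := ne_top_of_le_ne_top (hfin a) (h2 ▸ le_self_add)
  rw [← h2, two_mul] at h1 ⊢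
  have h3 := (ENNReal.add_le_add_iff_left hu).1 h1
  gcongr

/-- The level sets decrease in `k`, so one-step differences are disjoint; a two-step difference is
the union of two of these, whence the factor 2. -/
theorem tsum_setLIntegral_diff_le [Countable ι] (hQ : ∀ a, MeasurableSet (N.set a))
    (hb : 1 < b) (G : α → ℝ≥0∞) :
    ∑' k : ℤ, ∫⁻ x in N.levelSet A (b ^ k) \ N.levelSet A (b ^ (k + 2)), G x ∂μ ≤
      2 * ∫⁻ x, G x ∂μ := by
  set U : ℤ → Set α := fun k => N.levelSet A (b ^ k)
  have hU : Antitone U := fun i j h => N.levelSet_anti (ENNReal.zpow_le_of_le hb.le h)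
  have hUm : ∀ k, MeasurableSet (U k) := fun k => N.measurableSet_levelSet hQ _
  have h1 : ∑' k : ℤ, ∫⁻ x in U k \ U (k + 1), G x ∂μ ≤ ∫⁻ x, G x ∂μ := by
    rw [← lintegral_iUnion (fun k => (hUm k).diff (hUm _))]
    · exact setLIntegral_le_lintegral _ _
    · have key : ∀ i j : ℤ, i < j → Disjoint (U i \ U (i + 1)) (U j \ U (j + 1)) :=
        fun i j h => Set.disjoint_left.2 fun x hx hx' => hx.2 (hU (by lia) hx'.1)
      intro i j hij
      rcases lt_or_gt_of_ne hij with h | h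
      · exact key i j h
      · exact (key j i h).symm
  have h2 : ∀ k : ℤ, ∫⁻ x in U k \ U (k + 2), G x ∂μ ≤
      ∫⁻ x in U k \ U (k + 1), G x ∂μ + ∫⁻ x in U (k + 1) \ U (k + 1 + 1), G x ∂μ := by
    intro k
    refine le_trans (lintegral_mono_set ?_) (lintegral_union_le _ _ _)
    intro x hx
    by_cases h : x ∈ U (k + 1)
    · exact Or.inr ⟨h, by rw [add_assoc]; exact hx.2⟩
    · exact Or.inl ⟨hx.1, h⟩
  refine (ENNReal.tsum_le_tsum h2).trans ?_
  rw [ENNReal.tsum_add, two_mul]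
  refine add_le_add h1 (le_trans (le_of_eq ?_) h1)
  exact (Equiv.addRight (1 : ℤ)).tsum_eq (fun k => ∫⁻ x in U k \ U (k + 1), G x ∂μ)

theorem tsum_principal_setLIntegral_le [Countable ι] (hQ : ∀ a, MeasurableSet (N.set a))
    (hb : 1 < b) (G : α → ℝ≥0∞) :
    ∑' (k : ℤ) (a : N.principal A b k),
      ∫⁻ x in N.set a \ N.levelSet A (b ^ (k + 2)), G x ∂μ ≤ 2 * ∫⁻ x, G x ∂μ := by
  refine le_trans (ENNReal.tsum_le_tsum fun k => ?_)
    (N.tsum_setLIntegral_diff_le (A := A) hQ hb G)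
  rw [← lintegral_biUnion (Set.to_countable _)
    (fun a _ => (hQ a).diff (N.measurableSet_levelSet (A := A) hQ (b ^ (k + 2))))]
  · refine lintegral_mono_set ?_
    refine Set.iUnion₂_subset fun a ha => Set.sdiff_subset_sdiff_left ?_
    exact Set.subset_biUnion_of_mem (u := N.set) ha.1
  · intro a ha c hc hac
    exact (N.pairwiseDisjoint_stopping _ ha.1 hc.1 hac).mono Set.sdiff_subset Set.sdiff_subset

/-- The strong type inequality for the maximal operator over a nested family with the packing
property, from a testing condition on each set of the family. -/
theorem lintegral_maximal_rpow_le [Countable ι] (hQ : ∀ a, MeasurableSet (N.set a))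
    (hfin : ∀ a, μ (N.set a) ≠ ∞) (hA : ∀ a, A a ≠ ∞) (hb : 1 < b) (hb' : b ≠ ∞)
    (hN : N.Packing A μ b) {q s : ℝ} (hq : 0 < q) (hs : 1 ≤ s) {D : ℝ≥0∞} {G : α → ℝ≥0∞} {c : ι → ℝ≥0∞}
    (hcG : ∀ a, ∀ x ∈ N.set a, c a ≤ G x)
    (hc : ∀ a, A a ^ q * σ (N.set a) ≤ (D * (μ (N.set a) * c a)) ^ s) :
    ∫⁻ x, N.maximal A x ^ q ∂σ ≤ b ^ q * (D * (4 * ∫⁻ x, G x ∂μ)) ^ s := by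
  have hb0 : b ≠ 0 := (zero_lt_one.trans hb).ne'
  have hs0 : 0 < s := zero_lt_one.trans_le hs
  have hterm : ∀ (k : ℤ) (a : N.principal A b k), (b ^ (k + 1)) ^ q * σ (N.set a) ≤
      b ^ q * (D * (2 * ∫⁻ x in N.set a \ N.levelSet A (b ^ (k + 2)), G x ∂μ)) ^ s := by
    intro k a
    have h1 : (b ^ (k + 1)) ^ q ≤ b ^ q * A a ^ q := by
      rw [← ENNReal.mul_rpow_of_nonneg _ _ hq.le, ENNReal.zpow_add hb0 hb', zpow_one, mul_comm]
      gcongr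
      exact a.2.1.1.le
    have h2 : A a ^ q * σ (N.set a) ≤
        (D * (2 * ∫⁻ x in N.set a \ N.levelSet A (b ^ (k + 2)), G x ∂μ)) ^ s := by
      set E := N.set a \ N.levelSet A (b ^ (k + 2))
      have hE : MeasurableSet E := (hQ _).diff (N.measurableSet_levelSet hQ _)
      have h3 : μ E * c a ≤ ∫⁻ x in E, G x ∂μ := by
        rw [mul_comm, ← setLIntegral_const]
        exact setLIntegral_mono' hE fun x hx => hcG a x hx.1
      refine (hc a).trans ?_
      have h4 : μ (N.set a) * c a ≤ 2 * ∫⁻ x in E, G x ∂μ :=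
        calc _ ≤ 2 * μ E * c a := by
              gcongr
              exact N.measure_le_two_mul_diff hQ hfin hb hb' hN a.2
          _ ≤ _ := by
              rw [mul_assoc]
              exact mul_le_mul_right h3 2
      gcongr
    calc _ ≤ b ^ q * A a ^ q * σ (N.set a) := by gcongr
      _ ≤ _ := by rw [mul_assoc]; gcongr
  calc ∫⁻ x, N.maximal A x ^ q ∂σ
      ≤ ∫⁻ x, ∑' (k : ℤ) (a : N.principal A b k),
        (N.set a).indicator (fun _ => (b ^ (k + 1)) ^ q) x ∂σ :=
        lintegral_mono fun x => N.maximal_rpow_le hA hb hb' hq x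
    _ = ∑' (k : ℤ) (a : N.principal A b k), (b ^ (k + 1)) ^ q * σ (N.set a) := by
        have hm : ∀ (k : ℤ) (a : N.principal A b k), Measurable
            ((N.set a).indicator (fun _ : α => (b ^ (k + 1)) ^ q)) := fun k a =>
          measurable_const.indicator (hQ _)
        rw [lintegral_tsum fun k => (Measurable.tsum (hm k)).aemeasurable]
        refine tsum_congr fun k => ?_
        rw [lintegral_tsum fun a => (hm k a).aemeasurable]
        exact tsum_congr fun a => lintegral_indicator_const (hQ _) _
    _ ≤ ∑' (k : ℤ) (a : N.principal A b k),
        b ^ q * (D * (2 * ∫⁻ x in N.set a \ N.levelSet A (b ^ (k + 2)), G x ∂μ)) ^ s :=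
        ENNReal.tsum_le_tsum fun k => ENNReal.tsum_le_tsum fun a => hterm k a
    _ ≤ b ^ q * (∑' (k : ℤ) (a : N.principal A b k),
        D * (2 * ∫⁻ x in N.set a \ N.levelSet A (b ^ (k + 2)), G x ∂μ)) ^ s := by
        simp only [ENNReal.tsum_mul_left (a := b ^ q)]
        gcongr
        refine le_trans (ENNReal.tsum_le_tsum fun k => ?_) (ENNReal.tsum_rpow_le_rpow_tsum _ hs)
        exact ENNReal.tsum_rpow_le_rpow_tsum _ hs
    _ ≤ _ := by
        simp only [ENNReal.tsum_mul_left]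
        have h := mul_le_mul_right (N.tsum_principal_setLIntegral_le (A := A) (μ := μ) hQ hb G) 2
        -- One factor 2 comes from keeping half of each principal set, the other from the overlap of
        -- the remainders.
        rw [← mul_assoc, show (2 : ℝ≥0∞) * 2 = 4 by norm_num] at h
        gcongr

end NestedFamily

/-! ### Packing for multilinear averages over cubes. -/

theorem ENNReal.tsum_prod_rpow_le {ι κ : Type*} (s : Finset κ) (f : κ → ι → ℝ≥0∞) {p : κ → ℝ}
    (hp : ∑ i ∈ s, p i = 1) (hp0 : ∀ i ∈ s, 0 ≤ p i) :
    ∑' a, ∏ i ∈ s, f i a ^ p i ≤ ∏ i ∈ s, (∑' a, f i a) ^ p i := by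
  let _ : MeasurableSpace ι := ⊤
  have h := ENNReal.lintegral_prod_norm_pow_le (μ := Measure.count) s (f := f)
    (fun i _ => measurable_from_top.aemeasurable) hp hp0
  simpa only [lintegral_count] using h

namespace Cube

variable {n m : ℕ}

theorem isOpen_toSet (Q : Cube n) : IsOpen Q.toSet :=
  isOpen_set_pi Set.finite_univ fun _ _ => isOpen_Ioo

theorem measurableSet_toSet (Q : Cube n) : MeasurableSet Q.toSet := Q.isOpen_toSet.measurableSet

theorem volume_toSet (Q : Cube n) : volume Q.toSet = ENNReal.ofReal (Q.side ^ n) := by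
  simp [toSet, Real.volume_pi_Ioo, ENNReal.ofReal_pow Q.side_pos.le]

theorem vol_pos (Q : Cube n) : 0 < Q.vol := by
  rw [vol_eq]
  exact pow_pos Q.side_pos n

theorem volume_eq_ofReal_vol (Q : Cube n) : volume Q.toSet = ENNReal.ofReal Q.vol := by
  rw [vol_eq, volume_toSet]

theorem volume_ne_top (Q : Cube n) : volume Q.toSet ≠ ∞ := by simp [volume_toSet]

theorem volume_ne_zero (Q : Cube n) : volume Q.toSet ≠ 0 := by
  rw [volume_eq_ofReal_vol]
  exact (ENNReal.ofReal_pos.2 Q.vol_pos).ne'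

/-- The multilinear average `φ(|Q|) ∏_i (1/|Q|) ∫_Q f_i`. -/
noncomputable def multiAverage (φ : ℝ → ℝ) (f : Fin m → (Fin n → ℝ) → ℝ≥0∞) (Q : Cube n) : ℝ≥0∞ :=
  ENNReal.ofReal (φ Q.vol) * ∏ i, ⨍⁻ y in Q.toSet, f i y ∂volume

theorem multiAverage_eq (φ : ℝ → ℝ) (f : Fin m → (Fin n → ℝ) → ℝ≥0∞) (Q : Cube n) :
    Q.multiAverage φ f =
      ENNReal.ofReal (φ Q.vol) * ((∏ i, ∫⁻ y in Q.toSet, f i y) / volume Q.toSet ^ m) := by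
  simp [multiAverage, setLAverage_eq, div_eq_mul_inv, Finset.prod_mul_distrib, ENNReal.inv_pow]

/-- The averages over disjoint subcubes of `Q` can be large only on a small part of `Q`. -/
theorem two_mul_measure_biUnion_le {ι : Type*} [Countable ι] {φ : ℝ → ℝ} {ρ : ℝ} (hρ : 0 < ρ)
    (hφ : ∀ t s, 0 < t → t ≤ s → φ t ≤ ρ * φ s) (hm : 0 < m)
    (f : Fin m → (Fin n → ℝ) → ℝ≥0∞) (Q : Cube n) (R : ι → Cube n) (T : Set ι) {t : ℝ≥0∞}
    (ht0 : t ≠ 0) (ht : t ≠ ∞) (hT : T.PairwiseDisjoint fun c => (R c).toSet)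
    (hR : ∀ c ∈ T, (R c).toSet ⊆ Q.toSet ∧ t < (R c).multiAverage φ f)
    (hQ : ENNReal.ofReal (ρ * 2 ^ m) * Q.multiAverage φ f ≤ t) :
    2 * volume (⋃ c ∈ T, (R c).toSet) ≤ volume Q.toSet := by
  have hm0 : (m : ℝ) ≠ 0 := by positivity
  have hmi : (0 : ℝ) ≤ (m : ℝ)⁻¹ := by positivity
  set κ : ℝ≥0∞ := ENNReal.ofReal (ρ * φ Q.vol) / t with hκ
  have hroot : ∀ x : ℝ≥0∞, (x ^ m) ^ (m : ℝ)⁻¹ = x := fun x => by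
    rw [← ENNReal.rpow_natCast, ENNReal.rpow_rpow_inv hm0]
  -- Solving `t < A_R` for `|R|` gives `|R|^m ≤ κ ∏ ∫_R f_i`. After an `m`-th root, Hölder's
  -- inequality for sums with `m` exponents `1/m` adds these bounds over the disjoint `R`.
  have hc : ∀ c : T, volume (R c).toSet ≤
      κ ^ (m : ℝ)⁻¹ * ∏ i, (∫⁻ y in (R c).toSet, f i y) ^ (m : ℝ)⁻¹ := by
    rintro ⟨c, hcT⟩
    obtain ⟨hsub, htc⟩ := hR c hcT
    set V := volume (R c).toSet
    have hV : V ^ m ≠ 0 := pow_ne_zero _ (R c).volume_ne_zero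
    have hV' : V ^ m ≠ ∞ := ENNReal.pow_ne_top (R c).volume_ne_top
    have hvol : (R c).vol ≤ Q.vol := measureReal_mono hsub Q.volume_ne_top
    rw [multiAverage_eq] at htc
    have h1 : t ≤ ENNReal.ofReal (ρ * φ Q.vol) * ((∏ i, ∫⁻ y in (R c).toSet, f i y) / V ^ m) :=
      htc.le.trans (by gcongr; exact hφ _ _ (R c).vol_pos hvol)
    have h2 : V ^ m ≤ κ * ∏ i, ∫⁻ y in (R c).toSet, f i y := by
      rw [hκ, ENNReal.div_eq_inv_mul, mul_assoc, ← ENNReal.div_eq_inv_mul,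
        ENNReal.le_div_iff_mul_le (Or.inl ht0) (Or.inl ht), mul_comm]
      rw [← mul_div_assoc] at h1
      exact (ENNReal.le_div_iff_mul_le (Or.inl hV) (Or.inl hV')).1 h1
    rw [ENNReal.prod_rpow_of_nonneg hmi, ← ENNReal.mul_rpow_of_nonneg _ _ hmi]
    conv_lhs => rw [← hroot V]
    gcongr
  have h1 : volume (⋃ c ∈ T, (R c).toSet) ≤ κ ^ (m : ℝ)⁻¹ *
      ∏ i, (∫⁻ y in Q.toSet, f i y) ^ (m : ℝ)⁻¹ := by
    rw [measure_biUnion (Set.to_countable T) hT fun c _ => (R c).measurableSet_toSet]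
    refine (ENNReal.tsum_le_tsum hc).trans ?_
    rw [ENNReal.tsum_mul_left]
    gcongr
    refine (ENNReal.tsum_prod_rpow_le _ _ (by simp [hm0]) fun _ _ => hmi).trans ?_
    gcongr with i
    rw [← lintegral_biUnion (Set.to_countable T) (fun c _ => (R c).measurableSet_toSet) hT]
    exact lintegral_mono_set (Set.iUnion₂_subset fun c hc => (hR c hc).1)
  set V := volume Q.toSet
  have hV : V ^ m ≠ 0 := pow_ne_zero _ Q.volume_ne_zero
  have hV' : V ^ m ≠ ∞ := ENNReal.pow_ne_top Q.volume_ne_top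
  -- The factor `2 ^ m` in the threshold becomes the required 2 after the `m`-th root; the factor
  -- `ρ` pays for replacing `φ(|R|)` by `φ(|Q|)`.
  have h2 : 2 ^ m * (κ * ∏ i, ∫⁻ y in Q.toSet, f i y) ≤ V ^ m := by
    rw [multiAverage_eq, ENNReal.ofReal_mul hρ.le, ← mul_div_assoc, ← mul_div_assoc,
      ENNReal.div_le_iff hV hV', ENNReal.ofReal_pow zero_le_two, ENNReal.ofReal_ofNat] at hQ
    rw [hκ, ENNReal.ofReal_mul hρ.le, ENNReal.div_eq_inv_mul, mul_assoc, mul_left_comm,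
      ← ENNReal.div_eq_inv_mul, ENNReal.div_le_iff ht0 ht]
    calc _ = _ := by ring
      _ ≤ _ := hQ
      _ = _ := mul_comm _ _
  have h3 := ENNReal.rpow_le_rpow h2 hmi
  rw [hroot, ENNReal.mul_rpow_of_nonneg _ _ hmi, ENNReal.mul_rpow_of_nonneg _ _ hmi, hroot,
    ← ENNReal.prod_rpow_of_nonneg hmi] at h3
  exact (mul_le_mul_right h1 2).trans h3

end Cube

/-! ### Hölder's inequality for averages, and the testing inequality. -/

namespace BanachFunctionSpace

variable {n : ℕ} (X : BanachFunctionSpace n)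

/-- Hölder's inequality for a Banach function space and its associate space. -/
theorem lintegral_mul_le {u v : (Fin n → ℝ) → ℝ≥0∞} (hu : AEMeasurable u volume)
    (hv : AEMeasurable v volume) : ∫⁻ x, u x * v x ≤ X.norm u * X.assoc.norm v := by
  rcases eq_or_ne (X.norm u) 0 with h0 | h0
  · have := (X.norm_eq_zero_iff u hu).1 h0
    rw [lintegral_congr_ae (g := fun _ => 0) (this.mono fun x hx => by simp [hx])]
    simp
  rcases eq_or_ne (X.norm u) ∞ with h1 | h1
  · rcases eq_or_ne (X.assoc.norm v) 0 with h2 | h2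
    · have := (X.assoc.norm_eq_zero_iff v hv).1 h2
      rw [lintegral_congr_ae (g := fun _ => 0) (this.mono fun x hx => by simp [hx])]
      simp
    · simp [h1, ENNReal.top_mul h2]
  have hcoe : ((X.norm u).toNNReal⁻¹ : ℝ≥0) = (X.norm u)⁻¹ := by
    rw [ENNReal.coe_inv (by simp [ENNReal.toNNReal_eq_zero_iff, h0, h1]), ENNReal.coe_toNNReal h1]
  have h2 : X.norm (fun x => ((X.norm u).toNNReal⁻¹ : ℝ≥0) * u x) ≤ 1 := by
    rw [X.norm_const_mul _ _ hu, hcoe, ENNReal.inv_mul_cancel h0 h1]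
  have h3 := X.lintegral_le_assocNorm v (hu.const_mul _) h2
  simp only [mul_assoc] at h3
  rw [lintegral_const_mul' _ _ ENNReal.coe_ne_top, hcoe, ← ENNReal.div_eq_inv_mul,
    ENNReal.div_le_iff h0 h1, mul_comm] at h3
  exact h3

/-- The Jacobian of the dilation by `l(Q)` is exactly `1/|Q|` after the change of variables, so
Hölder's inequality for averages holds with constant 1. -/
theorem lintegral_comp_smul_indicator (Q : Cube n) (u : (Fin n → ℝ) → ℝ≥0∞) :
    ∫⁻ x, Q.toSet.indicator u (Q.side • x) = ⨍⁻ x in Q.toSet, u x ∂volume := by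
  have hs : Q.side ≠ 0 := Q.side_pos.ne'
  have h := lintegral_map_equiv (μ := (volume : Measure (Fin n → ℝ))) (Q.toSet.indicator u)
    (Homeomorph.smulOfNeZero Q.side hs).toMeasurableEquiv
  simp only [Homeomorph.toMeasurableEquiv_coe, Homeomorph.smulOfNeZero_apply] at h
  rw [← h]
  have h2 : Measure.map (fun x : Fin n → ℝ => Q.side • x) volume = _ :=
    Measure.map_addHaar_smul volume hs
  rw [h2, lintegral_smul_measure,
    lintegral_indicator Q.measurableSet_toSet, setLAverage_eq, Q.volume_toSet,
    ENNReal.div_eq_inv_mul, Module.finrank_fin_fun,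
    abs_of_pos (inv_pos.2 (pow_pos Q.side_pos n)), ENNReal.ofReal_inv_of_pos
      (pow_pos Q.side_pos n), smul_eq_mul]

theorem aemeasurable_comp_smul_indicator (Q : Cube n) {u : (Fin n → ℝ) → ℝ≥0∞}
    (hu : AEMeasurable u volume) :
    AEMeasurable (fun x => Q.toSet.indicator u (Q.side • x)) volume :=
  (hu.indicator Q.measurableSet_toSet).comp_quasiMeasurePreserving
    (Measure.quasiMeasurePreserving_smul volume Q.side_pos.ne')

theorem laverage_mul_le (Q : Cube n) {u v : (Fin n → ℝ) → ℝ≥0∞} (hu : AEMeasurable u volume)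
    (hv : AEMeasurable v volume) :
    ⨍⁻ x in Q.toSet, u x * v x ∂volume ≤ X.average u Q * X.assoc.average v Q := by
  rw [← lintegral_comp_smul_indicator]
  simp only [Set.indicator_mul]
  exact X.lintegral_mul_le (aemeasurable_comp_smul_indicator Q hu)
    (aemeasurable_comp_smul_indicator Q hv)

/-- Hölder's inequality against the constant 1, whose `X'`-average is finite because the dilated
cube has measure 1. Applied to `w⁻¹`, it shows that `w > 0` a.e. on `Q`. -/
theorem laverage_lt_top (Q : Cube n) {u : (Fin n → ℝ) → ℝ≥0∞} (hu : AEMeasurable u volume)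
    (h : X.average u Q ≠ ∞) : ⨍⁻ x in Q.toSet, u x ∂volume < ∞ := by
  have h1 := X.laverage_mul_le Q hu (aemeasurable_const (b := (1 : ℝ≥0∞)))
  simp only [mul_one] at h1
  refine h1.trans_lt (ENNReal.mul_lt_top h.lt_top ?_)
  have hm := Q.measurableSet_toSet.preimage (measurable_const_smul (α := Fin n → ℝ) Q.side)
  have h2 : (fun x : Fin n → ℝ => Q.toSet.indicator (fun _ => (1 : ℝ≥0∞)) (Q.side • x)) =
      ((fun x : Fin n → ℝ => Q.side • x) ⁻¹' Q.toSet).indicator fun _ => 1 := rfl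
  refine (congrArg X.assoc.norm h2).trans_lt (X.assoc.norm_indicator_lt_top _ hm ?_)
  rw [← lintegral_indicator_one hm]
  have h3 := lintegral_comp_smul_indicator Q (fun _ => 1)
  rw [h2] at h3
  refine lt_of_eq_of_lt h3 ?_
  rw [setLAverage_eq, setLIntegral_one, ENNReal.div_self Q.volume_ne_zero Q.volume_ne_top]
  exact ENNReal.one_lt_top

theorem average_ne_zero (Q : Cube n) {u : (Fin n → ℝ) → ℝ≥0∞} (hu : AEMeasurable u volume)
    (hpos : ∀ x, u x ≠ 0) : X.average u Q ≠ 0 := by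
  intro h
  have h1 := (X.norm_eq_zero_iff _ (aemeasurable_comp_smul_indicator Q hu)).1 h
  have h2 := lintegral_comp_smul_indicator Q u
  rw [lintegral_congr_ae h1, setLAverage_eq, eq_comm, Pi.zero_def, lintegral_zero,
    ENNReal.div_eq_zero_iff] at h2
  rcases h2 with h2 | h2
  · rw [lintegral_eq_zero_iff' hu.restrict] at h2
    have h3 : ∀ᵐ x ∂(volume.restrict Q.toSet), False := h2.mono fun x hx => hpos x hx
    simp [Q.volume_ne_zero] at h3
  · exact Q.volume_ne_top h2

/-- Hölder's inequality with a weight. -/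
theorem laverage_le_average_inv_mul (Q : Cube n) {f w : (Fin n → ℝ) → ℝ≥0∞}
    (hf : AEMeasurable f volume) (hw : AEMeasurable w volume) (hwt : ∀ x, w x ≠ ∞)
    (h : X.average (fun x => (w x)⁻¹) Q ≠ ∞) :
    ⨍⁻ x in Q.toSet, f x ∂volume ≤
      X.average (fun x => (w x)⁻¹) Q * X.assoc.average (fun x => f x * w x) Q := by
  refine le_trans (le_of_eq ?_) (X.laverage_mul_le Q hw.inv (hf.mul hw))
  have h1 := X.laverage_lt_top Q hw.inv h
  rw [setLAverage_eq] at h1 ⊢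
  have h2 : ∫⁻ x in Q.toSet, (w x)⁻¹ ≠ ∞ := by
    intro h3
    simp [h3, ENNReal.top_div_of_ne_top Q.volume_ne_top] at h1
  rw [setLAverage_eq]
  congr 1
  refine lintegral_congr_ae ?_
  -- The factorization `f = w⁻¹ * (f * w)` can fail only where `w = 0`, a null part of `Q`.
  filter_upwards [ae_lt_top' hw.inv.restrict h2] with x hx
  have hx0 : w x ≠ 0 := by rintro h0; simp [h0] at hx
  rw [mul_comm (f x), ← mul_assoc, ENNReal.inv_mul_cancel hx0 (hwt x), one_mul]

end BanachFunctionSpace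

/-- The testing inequality on a cube: the weight condition bounds the multilinear averages by the
averages in the associate spaces. -/
theorem multiAverage_rpow_mul_le {n m : ℕ} {φ : ℝ → ℝ} (hφ : ∀ t, 0 < t → 0 < φ t) {p q : ℝ}
    (hp : 0 < p) (hq : 0 < q) (Y : Fin m → BanachFunctionSpace n) (Q : Cube n) {C : ℝ≥0}
    {ν : (Fin n → ℝ) → ℝ≥0} {w : Fin m → (Fin n → ℝ) → ℝ≥0} (hw : ∀ i, AEMeasurable (w i) volume)
    (hC : ENNReal.ofReal (φ Q.vol * Q.vol ^ (1 / q - 1 / p)) *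
      (⨍⁻ x in Q.toSet, (ν x : ℝ≥0∞) ^ q ∂volume) ^ (1 / q) *
      ∏ i, (Y i).average (fun x => (w i x : ℝ≥0∞)⁻¹) Q ≤ C)
    {f : Fin m → (Fin n → ℝ) → ℝ≥0∞} (hf : ∀ i, AEMeasurable (f i) volume) :
    Q.multiAverage φ f ^ q * ∫⁻ x in Q.toSet, (ν x : ℝ≥0∞) ^ q ≤
      ((C : ℝ≥0∞) ^ p * (volume Q.toSet *
        (∏ i, (Y i).assoc.average (fun x => f i x * w i x) Q) ^ p)) ^ (q / p) := by
  -- If `ν` vanishes a.e. on `Q`, the weight condition allows infinite averages of `w_i⁻¹`, but the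
  -- left side is 0.
  rcases eq_or_ne (∫⁻ x in Q.toSet, (ν x : ℝ≥0∞) ^ q) 0 with h0 | h0
  · simp [h0]
  have hV := Q.volume_ne_zero
  have hV' := Q.volume_ne_top
  set B := (⨍⁻ x in Q.toSet, (ν x : ℝ≥0∞) ^ q ∂volume) ^ (1 / q) with hB
  set V := volume Q.toSet with hVdef
  have hBV : ∫⁻ x in Q.toSet, (ν x : ℝ≥0∞) ^ q = (B * V ^ (1 / q)) ^ q := by
    rw [ENNReal.mul_rpow_of_nonneg _ _ hq.le, hB, ← ENNReal.rpow_mul, ← ENNReal.rpow_mul,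
      one_div_mul_cancel hq.ne', ENNReal.rpow_one, ENNReal.rpow_one, setLAverage_eq,
      ENNReal.div_mul_cancel hV hV']
  have hB0 : B ≠ 0 := by
    intro h
    rw [hBV, h] at h0
    simp [hq] at h0
  set W : Fin m → ℝ≥0∞ := fun i => (Y i).average (fun x => (w i x : ℝ≥0∞)⁻¹) Q with hW
  set U : Fin m → ℝ≥0∞ := fun i => (Y i).assoc.average (fun x => f i x * w i x) Q with hU
  have hwm : ∀ i, AEMeasurable (fun x => (w i x : ℝ≥0∞)) volume := fun i =>
    (hw i).coe_nnreal_ennreal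
  have hW0 : ∀ i, W i ≠ 0 := fun i => (Y i).average_ne_zero Q (hwm i).inv fun x => by simp
  have hc0 : ENNReal.ofReal (φ Q.vol * Q.vol ^ (1 / q - 1 / p)) ≠ 0 :=
    (ENNReal.ofReal_pos.2 (mul_pos (hφ _ Q.vol_pos) (Real.rpow_pos_of_pos Q.vol_pos _))).ne'
  -- An infinite factor would make the whole product infinite, as no other factor is 0.
  have hWt : ∀ i, W i ≠ ∞ := by
    intro i hi
    have h1 : ∏ j, W j = ∞ := by
      rw [← Finset.mul_prod_erase _ _ (Finset.mem_univ i), hi,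
        ENNReal.top_mul (Finset.prod_ne_zero_iff.2 fun j _ => hW0 j)]
    rw [h1, ENNReal.mul_top (mul_ne_zero hc0 hB0)] at hC
    exact ENNReal.coe_ne_top (top_le_iff.1 hC)
  have hA : Q.multiAverage φ f ≤ ENNReal.ofReal (φ Q.vol) * ((∏ i, W i) * ∏ i, U i) := by
    rw [Cube.multiAverage, ← Finset.prod_mul_distrib]
    gcongr with i
    exact (Y i).laverage_le_average_inv_mul Q (hf i) (hwm i) (fun x => ENNReal.coe_ne_top) (hWt i)
  have hφV : ENNReal.ofReal (φ Q.vol * Q.vol ^ (1 / q - 1 / p)) =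
      ENNReal.ofReal (φ Q.vol) * V ^ (1 / q - 1 / p) := by
    rw [ENNReal.ofReal_mul (hφ _ Q.vol_pos).le, hVdef, Q.volume_eq_ofReal_vol,
      ENNReal.ofReal_rpow_of_pos Q.vol_pos]
  have hkey : Q.multiAverage φ f * (B * V ^ (1 / q)) ≤ C * (V ^ (1 / p) * ∏ i, U i) := by
    calc Q.multiAverage φ f * (B * V ^ (1 / q))
        ≤ ENNReal.ofReal (φ Q.vol) * ((∏ i, W i) * ∏ i, U i) *
          (B * (V ^ (1 / q - 1 / p) * V ^ (1 / p))) := by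
          rw [← ENNReal.rpow_add _ _ hV hV', sub_add_cancel]
          gcongr
      _ = (ENNReal.ofReal (φ Q.vol) * V ^ (1 / q - 1 / p) * B * ∏ i, W i) *
          (V ^ (1 / p) * ∏ i, U i) := by ring
      _ ≤ _ := by
          gcongr
          rw [← hφV]
          exact hC
  rw [hBV, ← ENNReal.mul_rpow_of_nonneg _ _ hq.le]
  refine (ENNReal.rpow_le_rpow hkey hq.le).trans (le_of_eq ?_)
  have h1 : V = (V ^ (1 / p)) ^ p := by
    rw [← ENNReal.rpow_mul, one_div_mul_cancel hp.ne', ENNReal.rpow_one]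
  conv_rhs => rw [h1]
  rw [← ENNReal.mul_rpow_of_nonneg _ _ hp.le, ← ENNReal.mul_rpow_of_nonneg _ _ hp.le,
    ← ENNReal.rpow_mul, mul_div_cancel₀ _ hp.ne']

/-! ### Shifted grids and reduction of general cubes to grid cubes. -/

/-- The one-third trick: a short interval lies in a grid interval, or in one of the grid shifted by
a third of the coarsest scale. -/
theorem exists_grid_interval_or_shift {h : ℝ} (hh : 0 < h) (j : ℕ) (c : ℝ) {l : ℝ}
    (hl : 3 * l ≤ h) :
    ∃ (e : Bool) (k : ℤ), (if e then h * 2 ^ j / 3 else 0) + k * h ≤ c ∧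
      c + l ≤ (if e then h * 2 ^ j / 3 else 0) + k * h + h := by
  set u : ℤ := ⌊c / h⌋ with hu
  set v : ℤ := ⌊(c - h * 2 ^ j / 3) / h⌋ with hv
  have hu1 : u * h ≤ c := (le_div_iff₀ hh).1 (Int.floor_le _)
  have hu2 : c < (u + 1) * h := (div_lt_iff₀ hh).1 (Int.lt_floor_add_one _)
  have hv1 : v * h ≤ c - h * 2 ^ j / 3 := (le_div_iff₀ hh).1 (Int.floor_le _)
  have hv2 : c - h * 2 ^ j / 3 < (v + 1) * h := (div_lt_iff₀ hh).1 (Int.lt_floor_add_one _)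
  by_cases h0 : c + l ≤ u * h + h
  · exact ⟨false, u, by simpa using hu1, by simpa using h0⟩
  by_cases h1 : c + l ≤ h * 2 ^ j / 3 + v * h + h
  · exact ⟨true, v, by simp; linarith, by simpa using h1⟩
  exfalso
  push Not at h0 h1
  -- Otherwise an endpoint of each grid lies in `(c, c + l)`, so the two differ by less than `h /
  -- 3`. Hence `|3 (u - v) - 2 ^ j| < 1`, which forces `3 ∣ 2 ^ j`.
  have e1 : (3 * ((u : ℝ) - v)) * h < (2 ^ j + 1) * h := by linarith
  have e2 : (2 ^ j - 1) * h < (3 * ((u : ℝ) - v)) * h := by linarith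
  have e3 := lt_of_mul_lt_mul_right e1 hh.le
  have e4 := lt_of_mul_lt_mul_right e2 hh.le
  have e5 : 3 * (u - v) < 2 ^ j + 1 := by exact_mod_cast e3
  have e6 : 2 ^ j - 1 < 3 * (u - v) := by exact_mod_cast e4
  have e7 : (3 : ℤ) ∣ 2 ^ j := ⟨u - v, by lia⟩
  have := Int.prime_three.dvd_of_dvd_pow e7
  norm_num at this

namespace Cube

variable {n m : ℕ}

/-- The cubes of the translate by `τ` of the grid of side length `L / 2 ^ j`, `j ∈ ℕ`. -/
noncomputable def grid (L : ℝ) (hL : 0 < L) (τ : Fin n → ℝ) (a : ℕ × (Fin n → ℤ)) : Cube n where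
  corner i := τ i + a.2 i * (L / 2 ^ a.1)
  side := L / 2 ^ a.1
  side_pos := by positivity

theorem mem_grid {L : ℝ} {hL : 0 < L} {τ : Fin n → ℝ} {a : ℕ × (Fin n → ℤ)} {x : Fin n → ℝ} :
    x ∈ (grid L hL τ a).toSet ↔ ∀ i, a.2 i * (L / 2 ^ a.1) < x i - τ i ∧
      x i - τ i < (a.2 i + 1) * (L / 2 ^ a.1) := by
  simp only [toSet, grid, Set.mem_univ_pi, Set.mem_Ioo]
  refine forall_congr' fun i => ?_
  constructor <;> rintro ⟨h1, h2⟩ <;> constructor <;> linarith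

/-- In units of the finer side a common point gives strict inequalities between integers, which
integrality sharpens to nesting. The case `d = 0` gives equality of the indices. -/
theorem grid_index_bounds {L : ℝ} (hL : 0 < L) {j d : ℕ} {k k' : ℤ} {y : ℝ}
    (h1 : k * (L / 2 ^ j) < y) (h2 : y < (k + 1) * (L / 2 ^ j))
    (h3 : k' * (L / 2 ^ (j + d)) < y) (h4 : y < (k' + 1) * (L / 2 ^ (j + d))) :
    k * 2 ^ d ≤ k' ∧ k' + 1 ≤ (k + 1) * 2 ^ d := by
  set h := L / 2 ^ (j + d) with hdef
  have hh : 0 < h := by positivity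
  have e : L / 2 ^ j = 2 ^ d * h := by rw [hdef, pow_add]; field_simp
  rw [e, ← mul_assoc] at h1 h2
  have e1 := lt_of_mul_lt_mul_right (h1.trans h4) hh.le
  have e2 := lt_of_mul_lt_mul_right (h3.trans h2) hh.le
  have e3 : k * 2 ^ d < k' + 1 := by exact_mod_cast e1
  have e4 : k' < (k + 1) * 2 ^ d := by exact_mod_cast e2
  exact ⟨by lia, by lia⟩

/-- The grid cubes form a nested family. -/
noncomputable def gridFamily (L : ℝ) (hL : 0 < L) (τ : Fin n → ℝ) :
    NestedFamily (ℕ × (Fin n → ℤ)) (Fin n → ℝ) where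
  set a := (grid L hL τ a).toSet
  gen a := a.1
  subset_of_gen_le := by
    rintro ⟨j, k⟩ ⟨j', k'⟩ hj ⟨y, hy, hy'⟩ x hx
    obtain ⟨d, rfl⟩ := Nat.exists_eq_add_of_le hj
    rw [mem_grid] at hx hy hy' ⊢
    intro i
    obtain ⟨h1, h2⟩ := grid_index_bounds hL (hy i).1 (hy i).2 (hy' i).1 (hy' i).2
    have h1' : (k i : ℝ) * 2 ^ d ≤ k' i := by exact_mod_cast h1
    have h2' : (k' i : ℝ) + 1 ≤ (k i + 1) * 2 ^ d := by exact_mod_cast h2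
    have hh : 0 < L / 2 ^ (j + d) := by positivity
    have e : L / 2 ^ j = 2 ^ d * (L / 2 ^ (j + d)) := by rw [pow_add]; field_simp
    obtain ⟨h3, h4⟩ := hx i
    simp only at h3 h4 ⊢
    rw [e, ← mul_assoc, ← mul_assoc]
    exact ⟨(mul_le_mul_of_nonneg_right h1' hh.le).trans_lt h3,
      h4.trans_le (mul_le_mul_of_nonneg_right h2' hh.le)⟩
  eq_of_gen_eq := by
    rintro ⟨j, k⟩ ⟨j', k'⟩ hj ⟨y, hy, hy'⟩
    obtain rfl : j = j' := hj
    rw [mem_grid] at hy hy'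
    congr 1
    funext i
    obtain ⟨h1, h2⟩ := grid_index_bounds (d := 0) hL (hy i).1 (hy i).2 (hy' i).1 (hy' i).2
    lia

/-- Every small cube is contained in a cube of comparable size of one of `2 ^ n` grids. -/
theorem exists_subset_grid {L : ℝ} (hL : 0 < L) (R : Cube n) (hR : 3 * R.side ≤ L) :
    ∃ (e : Fin n → Bool) (a : ℕ × (Fin n → ℤ)),
      R.toSet ⊆ (grid L hL (fun i => if e i then L / 3 else 0) a).toSet ∧
      (grid L hL (fun i => if e i then L / 3 else 0) a).side ≤ 6 * R.side := by
  have hs := R.side_pos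
  -- The scale satisfies `3 l(R) ≤ L / 2 ^ j < 6 l(R)`. The shift `L / 3` is the same at every
  -- scale, and choosing it coordinate by coordinate accounts for the `2 ^ n` grids.
  obtain ⟨j, hj, hj'⟩ := exists_nat_pow_near (x := L / (3 * R.side)) (y := 2)
    ((one_le_div (by positivity)).2 hR) one_lt_two
  rw [le_div_iff₀ (by positivity)] at hj
  rw [div_lt_iff₀ (by positivity), pow_succ] at hj'
  have hp : (0 : ℝ) < 2 ^ j := by positivity
  have hh : 0 < L / 2 ^ j := by positivity
  have h1 : 3 * R.side ≤ L / 2 ^ j := by rw [le_div_iff₀ hp]; linarith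
  have h2 : L / 2 ^ j ≤ 6 * R.side := by rw [div_le_iff₀ hp]; linarith
  have h3 : L / 2 ^ j * 2 ^ j = L := div_mul_cancel₀ _ hp.ne'
  choose e k hk hk' using fun i => exists_grid_interval_or_shift hh j (R.corner i) h1
  refine ⟨e, (j, k), fun x hx => ?_, h2⟩
  rw [toSet, Set.mem_univ_pi] at hx
  simp only [toSet, grid, Set.mem_univ_pi, Set.mem_Ioo]
  intro i
  have h4 := hk i
  have h5 := hk' i
  rw [h3] at h4 h5
  exact ⟨h4.trans_lt (hx i).1, (hx i).2.trans_le h5⟩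

theorem multiAverage_le_of_subset {φ : ℝ → ℝ} {ρ : ℝ} (hρ : 0 < ρ)
    (hφ : ∀ t s, 0 < t → t ≤ s → φ t ≤ ρ * φ s) (f : Fin m → (Fin n → ℝ) → ℝ≥0∞) {R Q : Cube n}
    (hRQ : R.toSet ⊆ Q.toSet) (hside : Q.side ≤ 6 * R.side) :
    R.multiAverage φ f ≤ ENNReal.ofReal ρ * (6 ^ n) ^ m * Q.multiAverage φ f := by
  have h1 : R.vol ≤ Q.vol := measureReal_mono hRQ Q.volume_ne_top
  have h2 : volume Q.toSet ≤ 6 ^ n * volume R.toSet := by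
    rw [volume_toSet, volume_toSet, ← ENNReal.ofReal_ofNat 6, ← ENNReal.ofReal_pow (by norm_num),
      ← ENNReal.ofReal_mul (by positivity), ← mul_pow]
    exact ENNReal.ofReal_le_ofReal (pow_le_pow_left₀ Q.side_pos.le hside n)
  have h3 : ∀ i, ⨍⁻ y in R.toSet, f i y ∂volume ≤ 6 ^ n * ⨍⁻ y in Q.toSet, f i y ∂volume := by
    intro i
    rw [setLAverage_eq, setLAverage_eq, ENNReal.div_le_iff R.volume_ne_zero R.volume_ne_top]
    calc ∫⁻ y in R.toSet, f i y ≤ ∫⁻ y in Q.toSet, f i y := lintegral_mono_set hRQ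
      _ = (∫⁻ y in Q.toSet, f i y) / volume Q.toSet * volume Q.toSet :=
        (ENNReal.div_mul_cancel Q.volume_ne_zero Q.volume_ne_top).symm
      _ ≤ (∫⁻ y in Q.toSet, f i y) / volume Q.toSet * (6 ^ n * volume R.toSet) := by gcongr
      _ = _ := by ring
  calc R.multiAverage φ f
      ≤ ENNReal.ofReal (ρ * φ Q.vol) * ∏ i, (6 ^ n * ⨍⁻ y in Q.toSet, f i y ∂volume) := by
        unfold multiAverage
        gcongr with i
        · exact hφ _ _ R.vol_pos h1
        · exact h3 i
    _ = _ := by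
        rw [ENNReal.ofReal_mul hρ.le, Finset.prod_mul_distrib, Finset.prod_const,
          Finset.card_univ, Fintype.card_fin, multiAverage]
        ring

/-! ### Strong type bounds from grids to all cubes. -/

/-- The supremum is uncountable; since the cubes are open, it is lower semicontinuous. -/
theorem measurable_iSup_cube (P : Cube n → Prop) (a : Cube n → ℝ≥0∞) :
    Measurable fun x => ⨆ (Q : Cube n) (_ : P Q) (_ : x ∈ Q.toSet), a Q := by
  refine LowerSemicontinuous.measurable (lowerSemicontinuous_biSup fun Q _ => ?_)
  convert Q.isOpen_toSet.lowerSemicontinuous_indicator (zero_le (a := a Q)) using 1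
  ext x
  by_cases hx : x ∈ Q.toSet <;> simp [hx]

variable {φ : ℝ → ℝ} {ρ : ℝ} {f : Fin m → (Fin n → ℝ) → ℝ≥0∞} {σ : Measure (Fin n → ℝ)}
  {q s : ℝ} {D : ℝ≥0∞} {G : (Fin n → ℝ) → ℝ≥0∞} {c : Cube n → ℝ≥0∞}

theorem packing_multiAverage {ι : Type*} [Countable ι] (hρ : 0 < ρ)
    (hφ : ∀ t s, 0 < t → t ≤ s → φ t ≤ ρ * φ s) (hm : 0 < m) (N : NestedFamily ι (Fin n → ℝ))
    (R : ι → Cube n) (hR : ∀ a, N.set a = (R a).toSet) :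
    N.Packing (fun a => (R a).multiAverage φ f) volume (ENNReal.ofReal (ρ * 2 ^ m)) := by
  obtain ⟨S, gen, h1, h2⟩ := N
  obtain rfl : S = fun a => (R a).toSet := funext hR
  intro a T t ht0 ht hT hRT hQ
  exact two_mul_measure_biUnion_le hρ hφ hm f (R a) R T ht0 ht hT hRT hQ

theorem lintegral_nestedFamily_maximal_le {ι : Type*} [Countable ι] (N : NestedFamily ι (Fin n → ℝ))
    (R : ι → Cube n) (hR : ∀ a, N.set a = (R a).toSet) (hφpos : ∀ t, 0 < t → 0 < φ t) (hρ : 0 < ρ)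
    (hφ : ∀ t s, 0 < t → t ≤ s → φ t ≤ ρ * φ s) (hm : 0 < m) (hq : 0 < q) (hs : 1 ≤ s)
    (hD : D ≠ ∞) (hG : ∫⁻ x, G x ≠ ∞) (hcG : ∀ Q : Cube n, ∀ x ∈ Q.toSet, c Q ≤ G x)
    (hc : ∀ Q : Cube n, Q.multiAverage φ f ^ q * σ Q.toSet ≤
      (D * (volume Q.toSet * c Q)) ^ s) :
    ∫⁻ x, N.maximal (fun a => (R a).multiAverage φ f) x ^ q ∂σ ≤
      ENNReal.ofReal (ρ * 2 ^ m) ^ q * (D * (4 * ∫⁻ x, G x)) ^ s := by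
  set A := fun a => (R a).multiAverage φ f with hA
  -- Comparing `φ 1` with itself gives `ρ ≥ 1`, so that `b = ρ * 2 ^ m` exceeds 1.
  have hρ1 : 1 ≤ ρ := by
    have h1 := hφ 1 1 one_pos le_rfl
    have h2 := hφpos 1 one_pos
    by_contra! h
    nlinarith
  have hb : 1 < ENNReal.ofReal (ρ * 2 ^ m) := by
    rw [ENNReal.one_lt_ofReal]
    have : (1 : ℝ) < 2 ^ m := one_lt_pow₀ one_lt_two hm.ne'
    nlinarith
  -- The stopping argument needs finite averages. Cubes with infinite average are `σ`-null, because
  -- the right side of the testing inequality is finite, and so they can be discarded.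
  set N' := N.restrict fun a => A a ≠ ∞ with hN'
  have hset : ∀ a, N'.set a = (R a).toSet := fun a => hR a
  have hpack := packing_multiAverage (f := f) hρ hφ hm N' (fun a => R a) hset
  have hmain : ∫⁻ x, N'.maximal (fun a => A a) x ^ q ∂σ ≤
      ENNReal.ofReal (ρ * 2 ^ m) ^ q * (D * (4 * ∫⁻ x, G x)) ^ s := by
    refine N'.lintegral_maximal_rpow_le (c := fun a => c (R a)) (fun a => ?_)
      (fun a => ?_) (fun a => a.2) hb ENNReal.ofReal_ne_top hpack hq hs (fun a => ?_) fun a => ?_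
    · rw [hset]; exact measurableSet_toSet _
    · rw [hset]; exact volume_ne_top _
    · rw [hset]; exact hcG _
    · rw [hset]; exact hc _
  refine le_trans (le_of_eq (lintegral_congr_ae ?_)) hmain
  have hnull : ∀ a, A a = ∞ → σ (R a).toSet = 0 := by
    intro a ha
    set Q := R a
    have h1 : volume Q.toSet * c Q ≤ ∫⁻ x, G x := by
      rw [mul_comm, ← setLIntegral_const]
      exact (setLIntegral_mono' Q.measurableSet_toSet (hcG Q)).trans
        (setLIntegral_le_lintegral _ _)
    have h2 : (D * (volume Q.toSet * c Q)) ^ s ≠ ∞ :=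
      ENNReal.rpow_ne_top_of_nonneg (by linarith)
        (ENNReal.mul_ne_top hD (ne_top_of_le_ne_top hG h1))
    have h3 := ne_top_of_le_ne_top h2 (hc Q)
    change A a ^ q * σ Q.toSet ≠ ∞ at h3
    rw [ha, ENNReal.top_rpow_of_pos hq] at h3
    by_contra h4
    exact h3 (ENNReal.top_mul h4)
  have hae : ∀ᵐ x ∂σ, ∀ a, A a = ∞ → x ∉ (R a).toSet := by
    rw [ae_all_iff]
    intro a
    by_cases ha : A a = ∞
    · filter_upwards [measure_eq_zero_iff_ae_notMem.1 (hnull a ha)] with x hx _ using hx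
    · simp [ha]
  filter_upwards [hae] with x hx
  congr 1
  refine le_antisymm (iSup₂_le fun a ha => ?_) (iSup₂_le fun a ha => ?_)
  · exact le_iSup₂_of_le (⟨a, fun h => hx a h (hR a ▸ ha)⟩ : {a // A a ≠ ∞}) ha le_rfl
  · exact le_iSup₂_of_le a.1 ha le_rfl

/-- The strong type inequality for the maximal operator over cubes of bounded size. -/
theorem lintegral_truncated_maximal_le (hφpos : ∀ t, 0 < t → 0 < φ t) (hρ : 0 < ρ)
    (hφ : ∀ t s, 0 < t → t ≤ s → φ t ≤ ρ * φ s) (hm : 0 < m) (hq : 0 < q) (hs : 1 ≤ s)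
    (hD : D ≠ ∞) (hG : ∫⁻ x, G x ≠ ∞) (hcG : ∀ Q : Cube n, ∀ x ∈ Q.toSet, c Q ≤ G x)
    (hc : ∀ Q : Cube n, Q.multiAverage φ f ^ q * σ Q.toSet ≤
      (D * (volume Q.toSet * c Q)) ^ s) {L : ℝ} (hL : 0 < L) :
    ∫⁻ x, (⨆ (R : Cube n) (_ : 3 * R.side ≤ L) (_ : x ∈ R.toSet), R.multiAverage φ f) ^ q ∂σ ≤
      (ENNReal.ofReal ρ * (6 ^ n) ^ m) ^ q *
        (2 ^ n * (ENNReal.ofReal (ρ * 2 ^ m) ^ q * (D * (4 * ∫⁻ x, G x)) ^ s)) := by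
  set κ := ENNReal.ofReal ρ * (6 ^ n) ^ m with hκ
  have hκt : κ ≠ ∞ := by finiteness
  set τ : (Fin n → Bool) → Fin n → ℝ := fun e i => if e i then L / 3 else 0 with hτ
  set M : (Fin n → Bool) → (Fin n → ℝ) → ℝ≥0∞ := fun e =>
    (gridFamily L hL (τ e)).maximal (fun a => (grid L hL (τ e) a).multiAverage φ f) with hM
  have hMm : ∀ e, Measurable (M e) := by
    intro e
    refine Measurable.iSup fun a => ?_
    have : (fun x => ⨆ (_ : x ∈ (gridFamily L hL (τ e)).set a),
        (grid L hL (τ e) a).multiAverage φ f) =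
        (grid L hL (τ e) a).toSet.indicator fun _ => (grid L hL (τ e) a).multiAverage φ f := by
      ext x
      by_cases hx : x ∈ (grid L hL (τ e) a).toSet <;> simp [gridFamily, hx]
    rw [this]
    exact measurable_const.indicator (measurableSet_toSet _)
  have hpt : ∀ x, (⨆ (R : Cube n) (_ : 3 * R.side ≤ L) (_ : x ∈ R.toSet), R.multiAverage φ f) ^ q
      ≤ κ ^ q * ∑ e, M e x ^ q := by
    intro x
    set B := κ ^ q * ∑ e, M e x ^ q with hB
    suffices h : (⨆ (R : Cube n) (_ : 3 * R.side ≤ L) (_ : x ∈ R.toSet), R.multiAverage φ f) ≤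
        B ^ q⁻¹ by
      refine (ENNReal.rpow_le_rpow h hq.le).trans (le_of_eq ?_)
      exact ENNReal.rpow_inv_rpow hq.ne' B
    refine iSup_le fun R => iSup_le fun hR => iSup_le fun hx => ?_
    obtain ⟨e, a, hsub, hside⟩ := exists_subset_grid hL R hR
    have h1 : R.multiAverage φ f ≤ κ * M e x :=
      (multiAverage_le_of_subset hρ hφ f hsub hside).trans
        (mul_le_mul_right (le_iSup₂_of_le a (hsub hx) le_rfl) κ)
    calc R.multiAverage φ f ≤ ((κ * M e x) ^ q) ^ q⁻¹ := by rwa [ENNReal.rpow_rpow_inv hq.ne']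
      _ ≤ B ^ q⁻¹ := by
        gcongr
        rw [ENNReal.mul_rpow_of_nonneg _ _ hq.le, hB]
        gcongr
        exact Finset.single_le_sum (f := fun e => M e x ^ q) (fun _ _ => zero_le)
          (Finset.mem_univ e)
  calc _ ≤ ∫⁻ x, κ ^ q * ∑ e, M e x ^ q ∂σ := lintegral_mono hpt
    _ = κ ^ q * ∑ e, ∫⁻ x, M e x ^ q ∂σ := by
        rw [lintegral_const_mul' _ _ (ENNReal.rpow_ne_top_of_nonneg hq.le hκt),
          lintegral_finsetSum _ fun e _ => (hMm e).pow_const q]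
    _ ≤ κ ^ q * ∑ _e : Fin n → Bool,
        ENNReal.ofReal (ρ * 2 ^ m) ^ q * (D * (4 * ∫⁻ x, G x)) ^ s := by
        gcongr with e
        exact lintegral_nestedFamily_maximal_le (gridFamily L hL (τ e)) (grid L hL (τ e))
          (fun _ => rfl) hφpos hρ hφ hm hq hs hD hG hcG hc
    _ = _ := by simp

/-- The strong type inequality for the multilinear maximal operator, from a testing condition. -/
theorem lintegral_multiMaximal_le (hφpos : ∀ t, 0 < t → 0 < φ t) (hρ : 0 < ρ)
    (hφ : ∀ t s, 0 < t → t ≤ s → φ t ≤ ρ * φ s) (hm : 0 < m) (hq : 0 < q) (hs : 1 ≤ s)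
    (hD : D ≠ ∞) (hG : ∫⁻ x, G x ≠ ∞) (hcG : ∀ Q : Cube n, ∀ x ∈ Q.toSet, c Q ≤ G x)
    (hc : ∀ Q : Cube n, Q.multiAverage φ f ^ q * σ Q.toSet ≤
      (D * (volume Q.toSet * c Q)) ^ s) :
    ∫⁻ x, (⨆ (R : Cube n) (_ : x ∈ R.toSet), R.multiAverage φ f) ^ q ∂σ ≤
      (ENNReal.ofReal ρ * (6 ^ n) ^ m) ^ q *
        (2 ^ n * (ENNReal.ofReal (ρ * 2 ^ m) ^ q * (D * (4 * ∫⁻ x, G x)) ^ s)) := by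
  -- Truncation at `L = k + 1`, which is positive also for `k = 0`, increases to the full operator.
  set M : ℕ → (Fin n → ℝ) → ℝ≥0∞ := fun k x =>
    ⨆ (R : Cube n) (_ : 3 * R.side ≤ (k : ℝ) + 1) (_ : x ∈ R.toSet), R.multiAverage φ f with hM
  have hsup : ∀ x, (⨆ (R : Cube n) (_ : x ∈ R.toSet), R.multiAverage φ f) ^ q =
      ⨆ k, M k x ^ q := by
    intro x
    have h1 := (ENNReal.orderIsoRpow q hq).map_iSup fun k => M k x
    simp only [ENNReal.orderIsoRpow_apply] at h1
    rw [← h1]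
    congr 1
    refine le_antisymm (iSup₂_le fun R hR => ?_) (iSup_le fun k => iSup_le fun R =>
      iSup_le fun _ => iSup_le fun hx => le_iSup₂_of_le R hx le_rfl)
    obtain ⟨k, hk⟩ := exists_nat_ge (3 * R.side)
    exact le_iSup_of_le k (le_iSup_of_le R (le_iSup_of_le (hk.trans (by simp))
      (le_iSup_of_le hR le_rfl)))
  simp only [hsup]
  rw [lintegral_iSup (fun k => (measurable_iSup_cube _ _).pow_const q)]
  · exact iSup_le fun k =>
      lintegral_truncated_maximal_le hφpos hρ hφ hm hq hs hD hG hcG hc (by positivity)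
  · intro k l hkl x
    refine ENNReal.rpow_le_rpow (iSup_mono fun R => iSup_mono' fun h => ⟨h.trans ?_, le_rfl⟩) hq.le
    have : (k : ℝ) ≤ l := by exact_mod_cast hkl
    linarith

end Cube

/-! ### Hölder's inequality for the product of maximal functions, and conclusion. -/

theorem BanachFunctionSpace.measurable_maximal {n : ℕ} (X : BanachFunctionSpace n)
    (f : (Fin n → ℝ) → ℝ) : Measurable (X.maximal f) := by
  have h := Cube.measurable_iSup_cube (fun _ => True) (X.average fun y => ‖f y‖ₑ)
  simp only [iSup_pos] at h
  exact h

theorem BanachFunctionSpace.average_le_maximal {n : ℕ} (X : BanachFunctionSpace n)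
    (f : (Fin n → ℝ) → ℝ) {Q : Cube n} {x : Fin n → ℝ} (hx : x ∈ Q.toSet) :
    X.average (fun y => ‖f y‖ₑ) Q ≤ X.maximal f x :=
  le_iSup₂_of_le Q hx le_rfl

/-- Hölder's inequality for a product of several functions. -/
theorem lintegral_prod_rpow_le_prod_eLpNorm {α ι : Type*} [Fintype ι] [MeasurableSpace α]
    {μ : Measure α} {F : ι → α → ℝ≥0∞} (hF : ∀ i, AEMeasurable (F i) μ) {p : ℝ} {r : ι → ℝ}
    (hp : 0 < p) (hr : ∀ i, 0 < r i) (hpr : 1 / p = ∑ i, 1 / r i) :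
    ∫⁻ x, (∏ i, F i x) ^ p ∂μ ≤ (∏ i, eLpNorm (F i) (ENNReal.ofReal (r i)) μ) ^ p := by
  have hsum : ∑ i, p / r i = 1 := by
    have h : ∑ i, p / r i = p * ∑ i, 1 / r i := by
      rw [Finset.mul_sum]
      exact Finset.sum_congr rfl fun i _ => by ring
    rw [h, ← hpr, mul_one_div_cancel hp.ne']
  have h := ENNReal.lintegral_prod_norm_pow_le (μ := μ) Finset.univ
    (f := fun i x => F i x ^ r i) (fun i _ => (hF i).pow_const _) hsum
    (fun i _ => (div_pos hp (hr i)).le)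
  refine le_trans (le_of_eq (lintegral_congr fun x => ?_)) (h.trans (le_of_eq ?_))
  · rw [← ENNReal.prod_rpow_of_nonneg hp.le]
    refine Finset.prod_congr rfl fun i _ => ?_
    rw [← ENNReal.rpow_mul, mul_div_cancel₀ _ (hr i).ne']
  · rw [← ENNReal.prod_rpow_of_nonneg hp.le]
    refine Finset.prod_congr rfl fun i _ => ?_
    rw [eLpNorm_eq_lintegral_rpow_enorm_toReal (by simpa using hr i) ENNReal.ofReal_ne_top,
      ENNReal.toReal_ofReal (hr i).le, ← ENNReal.rpow_mul]
    simp only [enorm_eq_self]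
    congr 1
    ring

theorem mainTheorem12 (n m : ℕ) (hn : 0 < n) (φ : ℝ → ℝ)
    (hφ_pos : ∀ t : ℝ, 0 < t → 0 < φ t)
    (hφ_mono : EssentiallyNondecreasing φ)
    (hφ_lim : Tendsto (fun t : ℝ => φ t / t) atTop (𝓝 0))
    (p q : ℝ) (r : Fin m → ℝ)
    (hp : 1 / (m : ℝ) < p) (hpq : p ≤ q) (hr : ∀ i, 1 < r i)
    (hpr : 1 / p = ∑ i, 1 / r i)
    (Y : Fin m → BanachFunctionSpace n)
    (hY : ∀ i, (Y i).assoc.MaximalBoundedOn (r i)) :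
    ∃ K : ℝ≥0, ∀ (C : ℝ≥0) (ν : (Fin n → ℝ) → ℝ≥0) (w : Fin m → (Fin n → ℝ) → ℝ≥0),
      0 < C → AEMeasurable ν volume → (∀ i, AEMeasurable (w i) volume) →
      (∀ Q : Cube n,
        ENNReal.ofReal (φ Q.vol * Q.vol ^ (1 / q - 1 / p)) *
            (⨍⁻ x in Q.toSet, (ν x : ℝ≥0∞) ^ q ∂volume) ^ (1 / q) *
            ∏ i, (Y i).average (fun x => (w i x : ℝ≥0∞)⁻¹) Q ≤ C) →
      ∀ f : Fin m → (Fin n → ℝ) → ℝ,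
        (∀ i, AEMeasurable (f i) volume) →
        (∀ i, MemLp (fun x => f i x * (w i x : ℝ)) (ENNReal.ofReal (r i)) volume) →
        eLpNorm (fun x => multilinearMaximal φ f x * (ν x : ℝ≥0∞)) (ENNReal.ofReal q) volume ≤
          K * C * ∏ i, eLpNorm (fun x => f i x * (w i x : ℝ)) (ENNReal.ofReal (r i)) volume := by
  have hp0 : 0 < p := lt_of_le_of_lt (by positivity) hp
  have hq0 : 0 < q := hp0.trans_le hpq
  have hm : 0 < m := by
    rcases Nat.eq_zero_or_pos m with rfl | h
    · have : 0 < 1 / p := by positivity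
      simp [hpr] at this
    · exact h
  have hr0 : ∀ i, 0 < r i := fun i => zero_lt_one.trans (hr i)
  obtain ⟨ρ, hρ, hφ⟩ := hφ_mono
  choose A hA using hY
  -- The factors come from enlarging a cube to a grid cube, from the number of grids, and from the
  -- level ratio `b = ρ * 2 ^ m`.
  set κ : ℝ≥0∞ := (ENNReal.ofReal ρ * (6 ^ n) ^ m) ^ q *
    (2 ^ n * ENNReal.ofReal (ρ * 2 ^ m) ^ q) with hκ
  set K : ℝ≥0∞ := κ ^ (1 / q) * (4 ^ (1 / p) * ∏ i, (A i : ℝ≥0∞)) with hK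
  have hKt : K ≠ ∞ := by
    have h1 : κ ≠ ∞ := by
      have := hq0.le
      finiteness
    have h2 : ∏ i, (A i : ℝ≥0∞) ≠ ∞ := ENNReal.prod_ne_top fun i _ => ENNReal.coe_ne_top
    have h3 : 0 ≤ 1 / q := by positivity
    have h4 : 0 ≤ 1 / p := by positivity
    finiteness
  refine ⟨K.toNNReal, fun C ν w _ hν hw hC f hf hfw => ?_⟩
  rw [ENNReal.coe_toNNReal hKt]
  set g : Fin m → (Fin n → ℝ) → ℝ := fun i x => f i x * (w i x : ℝ) with hg
  set N : ℝ≥0∞ := ∏ i, eLpNorm (g i) (ENNReal.ofReal (r i)) volume with hN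
  set G : (Fin n → ℝ) → ℝ≥0∞ := fun x => (∏ i, (Y i).assoc.maximal (g i) x) ^ p with hGdef
  have hGN : ∫⁻ x, G x ≤ ((∏ i, (A i : ℝ≥0∞)) * N) ^ p := by
    refine (lintegral_prod_rpow_le_prod_eLpNorm
      (fun i => ((Y i).assoc.measurable_maximal (g i)).aemeasurable) hp0 hr0 hpr).trans ?_
    rw [hN, ← Finset.prod_mul_distrib]
    gcongr with i
    exact hA i (g i) (hfw i)
  have hGt : ∫⁻ x, G x ≠ ∞ := by
    refine ne_top_of_le_ne_top (ENNReal.rpow_ne_top_of_nonneg hp0.le (ENNReal.mul_ne_top ?_ ?_)) hGN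
    · exact ENNReal.prod_ne_top fun i _ => ENNReal.coe_ne_top
    · exact ENNReal.prod_ne_top fun i _ => (hfw i).eLpNorm_ne_top
  have hνm : AEMeasurable (fun x => (ν x : ℝ≥0∞) ^ q) volume :=
    hν.coe_nnreal_ennreal.pow_const q
  set σ : Measure (Fin n → ℝ) := volume.withDensity fun x => (ν x : ℝ≥0∞) ^ q with hσ
  have hgw : ∀ i, (fun x => ‖f i x‖ₑ * (w i x : ℝ≥0∞)) = fun x => ‖g i x‖ₑ := by
    intro i
    ext x
    simp [hg, enorm_mul]
  -- With `D = C ^ p` and `s = q / p`, the final `q`-th root returns `C` to the first power.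
  have key := Cube.lintegral_multiMaximal_le (f := fun i x => ‖f i x‖ₑ) (σ := σ) (q := q)
    (s := q / p) (D := (C : ℝ≥0∞) ^ p) (G := G)
    (c := fun Q => (∏ i, (Y i).assoc.average (fun x => ‖f i x‖ₑ * (w i x : ℝ≥0∞)) Q) ^ p)
    hφ_pos hρ hφ hm hq0 ((one_le_div hp0).2 hpq)
    (ENNReal.rpow_ne_top_of_nonneg hp0.le ENNReal.coe_ne_top) hGt
    (fun Q x hx => by
      simp only [hgw, hGdef]
      gcongr with i
      exact (Y i).assoc.average_le_maximal (g i) hx)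
    (fun Q => by
      rw [hσ, withDensity_apply _ Q.measurableSet_toSet]
      exact multiAverage_rpow_mul_le hφ_pos hp0 hq0 Y Q hw (hC Q) fun i => (hf i).enorm)
  have hMm : Measurable (multilinearMaximal φ f) := by
    have h := Cube.measurable_iSup_cube (fun _ => True) (Cube.multiAverage φ fun i x => ‖f i x‖ₑ)
    simp only [iSup_pos] at h
    exact h
  have hLHS : ∫⁻ x, (⨆ (R : Cube n) (_ : x ∈ R.toSet),
      R.multiAverage φ fun i x => ‖f i x‖ₑ) ^ q ∂σ =
      ∫⁻ x, (multilinearMaximal φ f x * (ν x : ℝ≥0∞)) ^ q := by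
    rw [hσ]
    change ∫⁻ x, (multilinearMaximal φ f x) ^ q ∂_ = _
    rw [lintegral_withDensity_eq_lintegral_mul₀ hνm (hMm.pow_const q).aemeasurable]
    refine lintegral_congr fun x => ?_
    rw [Pi.mul_apply, ENNReal.mul_rpow_of_nonneg _ _ hq0.le, mul_comm]
  rw [hLHS] at key
  rw [eLpNorm_eq_lintegral_rpow_enorm_toReal (by simpa using hq0) ENNReal.ofReal_ne_top,
    ENNReal.toReal_ofReal hq0.le]
  simp only [enorm_eq_self]
  have hqi : 0 ≤ 1 / q := by positivity
  have hpi : 0 ≤ 1 / p := by positivity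
  have hpp : p * (1 / p) = 1 := mul_one_div_cancel hp0.ne'
  refine (ENNReal.rpow_le_rpow key hqi).trans ?_
  calc _ = (κ * ((C : ℝ≥0∞) ^ p * (4 * ∫⁻ x, G x)) ^ (q / p)) ^ (1 / q) := by
        congr 1
        rw [hκ]
        ring
    _ = κ ^ (1 / q) * (C * (4 ^ (1 / p) * (∫⁻ x, G x) ^ (1 / p))) := by
        rw [ENNReal.mul_rpow_of_nonneg _ _ hqi, ← ENNReal.rpow_mul,
          show q / p * (1 / q) = 1 / p by field_simp, ENNReal.mul_rpow_of_nonneg _ _ hpi,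
          ENNReal.mul_rpow_of_nonneg _ _ hpi, ← ENNReal.rpow_mul, hpp, ENNReal.rpow_one]
    _ ≤ κ ^ (1 / q) * (C * (4 ^ (1 / p) * ((∏ i, (A i : ℝ≥0∞)) * N))) := by
        have h := ENNReal.rpow_le_rpow hGN hpi
        rw [← ENNReal.rpow_mul, hpp, ENNReal.rpow_one] at h
        gcongr
    _ = K * C * N := by
        rw [hK]
        ring
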